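/- Let $d,K\in\mathbb N$, and for each sample index $t=1,2,\dots$ let $N_1,\dots,N_d$ (depending on $t$) be the sample sizes of the $d$ dimensions; limits, $O_p(\cdot)$ and "with probability approaching one" (wpa1) refer to $t\to\infty$. Consider random arrays in $\mathbb R^{N_1\times\dots\times N_d}$ with $$Y=\sum_{k=1}^K X_k\beta^0_k+\mathcal A+\varepsilon,\qquad \mathcal A=\sum_{\ell=1}^{L}\varphi^{(1)}_\ell\circ\dots\circ\varphi^{(d)}_\ell,$$ where $\beta^0\in\mathbb R^K$ is fixed, $\circ$ is the outer product, and the factors $\varphi^{(n)}_\ell\in\mathbb R^{N_n}$ may be fixed or random, with $L$ allowed to depend on $t$. For an array $A$ let $A_{(n)}\in\mathbb R^{N_n\times\prod_{m\ne n}N_m}$ be its flattening with dimension $n$ along the rows, let $\|A\|_F$ be its entrywise Euclidean norm and, for a matrix, let $\|\cdot\|$ be the spectral norm and $\sigma_1\ge\sigma_2\ge\dots$ the singular values. Let $r_n=\operatorname{rank}(\mathcal A_{(n)})$ be the $n$-th component of the multilinear rank of $\mathcal A$. For $\hat r_n\in\mathbb N$ (possibly data dependent) let $\hat\beta^{2D}_{(n)}$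 be the least-squares interactive fixed-effects estimator of Bai (2009) with $\hat r_n$ factors applied after flattening along dimension $n$, that is, any minimiser over $\beta\in\mathbb R^K$ of $$\min_{\varphi\in\mathbb R^{N_n\times\hat r_n},\ \Gamma\in\mathbb R^{\prod_{m\ne n}N_m\times\hat r_n}}\Big\|Y_{(n)}-\sum_{k}\beta_kX_{k,(n)}-\varphi\Gamma'\Big\|_F^2$$ (defined arbitrarily on outcomes for which no minimiser exists). Let $\mathcal L\subseteq\{1,\dots,d\}$ be non-empty and assume: 1. (Bounded norms) $\|X_k\|_F=O_p\big(\prod_{n}\sqrt{N_n}\big)$ for each $k$, and $\|\varepsilon_{(n^*)}\|=O_p\big(\max\{\sqrt{N_{n^*}},\prod_{m\ne n^*}\sqrt{N_m}\}\big)$ for each $n^*\in\mathcal L$. 2. (Weak exogeneity) $\operatorname{vec}(X_k)'\operatorname{vec}(\varepsilon)=O_p\big(\prod_n\sqrt{N_n}\big)$ for each $k$. 3. (Low multilinear rank) There is a positive integer $c$ not depending on $t$ with $r_{n^*}<c$ (almost surely) for all $n^*\in\mathcal L$ and all $t$. 4. (Non-singularity) For each $n^*\in\mathcal L$ there is a constant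 $b>0$ not depending on $t$ such that, wpa1, $$\min_{\delta\in\mathbb R^K,\ \|\delta\|=1}\ \sum_{s=r_{n^*}+\hat r_{n^*}+1}^{\min\{N_{n^*},\prod_{m\ne n^*}N_m\}}\sigma_s^2\left(\frac{\sum_k\delta_kX_{k,(n^*)}}{\prod_n\sqrt{N_n}}\right)>b .$$ 5. (Number of factors) For each $n^*\in\mathcal L$, $\hat r_{n^*}\ge r_{n^*}$ wpa1 and $\hat r_{n^*}=O_p(1)$ (in particular, $\hat r_{n^*}$ may be a fixed number not below $r_{n^*}$). Then for each $n^*\in\mathcal L$, $$\big\|\hat\beta^{2D}_{(n^*)}-\beta^0\big\|=O_p\left(\frac1{\sqrt{\min\{N_{n^*},\prod_{n\ne n^*}N_n\}}}\right).$$ -/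

import Mathlib

open MeasureTheory Filter Topology

namespace InteractiveFE

noncomputable section

/-- Real arrays of order `d` with `N n` levels in dimension `n`. -/
abbrev Tensor {d : ℕ} (N : Fin d → ℕ) : Type := (∀ n, Fin (N n)) → ℝ

/-- Joint index of all dimensions except `n`. -/
abbrev RestIdx {d : ℕ} (N : Fin d → ℕ) (n : Fin d) : Type :=
  ∀ m : {m : Fin d // m ≠ n}, Fin (N m)

/-- The factor-`n` flattening: dimension `n` varies along the rows, the remaining dimensions
vary jointly along the columns. -/
def flatten {d : ℕ} {N : Fin d → ℕ} (A : Tensor N) (n : Fin d) :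
    Matrix (Fin (N n)) (RestIdx N n) ℝ :=
  Matrix.of fun i j => A ((Equiv.piSplitAt n fun m => Fin (N m)).symm (i, j))

/-- The `n`-th component of the multilinear rank. -/
def multilinearRank {d : ℕ} {N : Fin d → ℕ} (A : Tensor N) (n : Fin d) : ℕ :=
  (flatten A n).rank

/-- The entrywise (Frobenius) norm of an array. -/
def frobNorm {d : ℕ} {N : Fin d → ℕ} (A : Tensor N) : ℝ := √(∑ i, A i ^ 2)

/-- The inner product `vec(A)' vec(B)`. -/
def vecInner {d : ℕ} {N : Fin d → ℕ} (A B : Tensor N) : ℝ := ∑ i, A i * B i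

/-- The sum `∑ ℓ, φ_ℓ^{(1)} ∘ ⋯ ∘ φ_ℓ^{(d)}` of outer products. -/
def interactiveEffect {d : ℕ} {N : Fin d → ℕ} {L : ℕ}
    (φ : Fin L → ∀ n, Fin (N n) → ℝ) : Tensor N :=
  fun i => ∑ l, ∏ n, φ l n (i n)

/-- `∏_{m ≠ n} N_m`, the number of columns of the factor-`n` flattening. -/
def restSize {d : ℕ} (N : Fin d → ℕ) (n : Fin d) : ℕ := ∏ m ∈ Finset.univ.erase n, N m

section Matrices

variable {I J : Type} [Fintype I] [Fintype J] [DecidableEq J]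

/-- The spectral norm: the operator norm for the Euclidean norms. -/
def spectralNorm (M : Matrix I J ℝ) : ℝ :=
  ‖LinearMap.toContinuousLinearMap (Matrix.toEuclideanLin M)‖

/-- The `s`-th largest singular value, counted from `s = 1`. -/
def singularValue (M : Matrix I J ℝ) (s : ℕ) : ℝ :=
  (Matrix.toEuclideanLin M).singularValues (s - 1)

end Matrices

/-- The least-squares objective `R(β, r, n)`: the infimum over all `φ ∈ ℝ^{N_n × r}` and
`Γ ∈ ℝ^{∏_{m ≠ n} N_m × r}` of `‖Y_(n) - ∑ₖ βₖ X_{(n),k} - φ Γ'‖_F²`. -/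
def lsObjective {d K : ℕ} {N : Fin d → ℕ} (Y : Tensor N) (X : Fin K → Tensor N)
    (β : EuclideanSpace ℝ (Fin K)) (r : ℕ) (n : Fin d) : ℝ :=
  ⨅ p : Matrix (Fin (N n)) (Fin r) ℝ × Matrix (RestIdx N n) (Fin r) ℝ,
    ∑ i, ∑ j, (flatten Y n - ∑ k, β k • flatten (X k) n - p.1 * p.2.transpose) i j ^ 2

/-- `β` is a least-squares estimate: a minimiser of `R(·, r, n)` over all of `ℝ^K`. -/
def IsLSEstimate {d K : ℕ} {N : Fin d → ℕ} (Y : Tensor N) (X : Fin K → Tensor N)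
    (r : ℕ) (n : Fin d) (β : EuclideanSpace ℝ (Fin K)) : Prop :=
  ∀ β' : EuclideanSpace ℝ (Fin K), lsObjective Y X β r n ≤ lsObjective Y X β' r n

section Asymptotics

variable {Ω : Type*} [MeasurableSpace Ω]

/-- `Z_t = O_p(a_t)` as `t → ∞`. -/
def IsBigOp (P : Measure Ω) (Z : ℕ → Ω → ℝ) (a : ℕ → ℝ) : Prop :=
  ∀ η : ℝ, 0 < η → ∃ M : ℝ, 0 < M ∧
    ∀ᶠ t in atTop, P {ω | M * a t < |Z t ω|} ≤ ENNReal.ofReal η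

/-- `E_t` holds with probability approaching one as `t → ∞`. -/
def WPA1 (P : Measure Ω) (E : ℕ → Ω → Prop) : Prop :=
  Tendsto (fun t => P {ω | ¬ E t ω}) atTop (𝓝 0)

end Asymptotics

end

end InteractiveFE

/-! Put `Δ = β₀ - β`, so the residual is `∑ Δₖ Xₖ + A + ε - φΓ'`. Both `A` and `φΓ'` vanish on a
subspace of codimension at most `q = rank A + r`. Summing squared norms only over orthonormal
vectors of that subspace removes them, without any factor estimation or prior consistency step
(`sum_sq_lower_bound`). There the regressors keep at least their singular values past the `q`-th,
hence mass above `b (τ‖Δ‖)²` with `τ = ∏ √N`. The noise keeps its full Frobenius mass up to `q‖ε‖²`.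
The cross term is the full inner product, controlled by exogeneity, up to the part on `q` discarded
directions. At `β₀` the objective is at most `‖ε‖_F²`, since `r ≥ rank A`. For any `β` doing no
worse, `‖ε‖_F²` cancels. Writing `τ = μg`, with `μ` and `g` the larger and smaller root dimensions,
and dividing by `μ²` leaves a quadratic inequality bounding `g‖Δ‖` (`norm_le_of_lowRankDistSq_le`).
The same bound makes sublevel sets bounded, so minimisers exist. All this is deterministic on an
event whose probability is controlled by the assumptions. -/

namespace InteractiveFE

/-! ### Discarding finitely many directions of a linear map -/

section LinearAlgebra

open Module

variable {E F : Type*} [NormedAddCommGroup E] [InnerProductSpace ℝ E] [FiniteDimensional ℝ E]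
  [NormedAddCommGroup F] [InnerProductSpace ℝ F] [FiniteDimensional ℝ F]

/-- An orthonormal basis adapted to a subspace of codimension at most `q`: all but its first `q`
vectors lie in the subspace. -/
theorem exists_orthonormalBasis_mem_of_finrank_orthogonal_le {n : ℕ} (hn : finrank ℝ E = n)
    (W : Submodule ℝ E) (q : ℕ) (hq : finrank ℝ Wᗮ ≤ q) :
    ∃ u : OrthonormalBasis (Fin n) ℝ E, ∀ i : Fin n, q ≤ i → u i ∈ W := by
  classical
  set p := finrank ℝ Wᗮ with hp
  let f := stdOrthonormalBasis ℝ Wᗮ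
  let v : Fin n → E := fun i => if h : (i : ℕ) < p then (f ⟨i, h⟩ : E) else 0
  have hv : Orthonormal ℝ (({i : Fin n | (i : ℕ) < p} : Set (Fin n)).domRestrict v) := by
    have h1 : Orthonormal ℝ (fun i : Fin p => (f i : E)) :=
      f.orthonormal.comp_linearIsometry Wᗮ.subtypeₗᵢ
    have h2 := h1.comp (fun i : {i : Fin n | (i : ℕ) < p} => (⟨i.1.1, i.2⟩ : Fin p)) (by
      intro i j hij
      simp only [Fin.mk.injEq] at hij
      exact Subtype.ext (Fin.ext hij))
    convert h2 using 1
    funext i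
    have hi : ((i : Fin n) : ℕ) < p := i.2
    simp [v, hi]
  obtain ⟨u, hu⟩ := hv.exists_orthonormalBasis_extension_of_card_eq (by simpa using hn)
  refine ⟨u, fun i hi => ?_⟩
  -- The first `p` vectors of `u` span `Wᗮ`, so any later vector is orthogonal to `Wᗮ` and lies in
  -- `Wᗮᗮ = W`.
  rw [← Submodule.orthogonal_orthogonal W, Submodule.mem_orthogonal]
  intro w hw
  have hpn : p ≤ n := hn ▸ Submodule.finrank_le Wᗮ
  have hwsum := f.sum_repr ⟨w, hw⟩
  have hw' : w = ∑ j, f.repr ⟨w, hw⟩ j • (f j : E) := by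
    have := congrArg (Subtype.val) hwsum
    simpa using this.symm
  rw [hw', sum_inner]
  refine Finset.sum_eq_zero fun j _ => ?_
  have hj : u ⟨j, j.2.trans_le hpn⟩ = (f j : E) := by
    rw [hu _ (show ((⟨j, j.2.trans_le hpn⟩ : Fin n) : ℕ) < p from j.2)]
    exact dif_pos j.2
  rw [inner_smul_left, ← hj, u.inner_eq_zero, mul_zero]
  intro h
  have := congrArg Fin.val h
  have := j.2
  simp at *
  omega

-- Codimension is subadditive under intersection, and the codimension of a kernel is the rank.
omit [FiniteDimensional ℝ F] in
theorem finrank_orthogonal_ker_inf_ker_le {G : Type*} [AddCommGroup G] [Module ℝ G]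
    [FiniteDimensional ℝ G] (S : E →ₗ[ℝ] F) (T : E →ₗ[ℝ] G) :
    finrank ℝ (S.ker ⊓ T.ker)ᗮ ≤ finrank ℝ S.range + finrank ℝ T.range := by
  have h1 := Submodule.finrank_add_finrank_orthogonal (S.ker ⊓ T.ker)
  have h2 := Submodule.finrank_sup_add_finrank_inf_eq S.ker T.ker
  have h3 := S.finrank_range_add_finrank_ker
  have h4 := T.finrank_range_add_finrank_ker
  have h5 := Submodule.finrank_le (S.ker ⊔ T.ker)
  omega

/-- The part of a linear map outside a `q`-dimensional subspace has at least the squared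
Frobenius mass of the singular values after the `q`-th. -/
theorem sum_sq_singularValues_le_sum_norm_sq {n : ℕ} (hn : finrank ℝ E = n) (T : E →ₗ[ℝ] F)
    (u : OrthonormalBasis (Fin n) ℝ E) (q : ℕ) :
    ∑ j : Fin n with q ≤ j.val, T.singularValues j ^ 2 ≤
      ∑ i : Fin n with q ≤ i.val, ‖T (u i)‖ ^ 2 := by
  classical
  let v := T.isSymmetric_adjoint_comp_self.eigenvectorBasis hn
  have hTu : ∀ x, ‖T x‖ ^ 2 = ∑ j : Fin n, T.singularValues j ^ 2 * inner ℝ (v j) x ^ 2 := by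
    intro x
    have h1 : ‖T x‖ ^ 2 = inner ℝ x ((LinearMap.adjoint T ∘ₗ T) x) := by
      rw [LinearMap.comp_apply, LinearMap.adjoint_inner_right, real_inner_self_eq_norm_sq]
    rw [h1, ← v.sum_inner_mul_inner]
    refine Finset.sum_congr rfl fun j _ => ?_
    have h2 : inner ℝ (v j) ((LinearMap.adjoint T ∘ₗ T) x) =
        T.singularValues j ^ 2 * inner ℝ (v j) x := by
      rw [← T.isSymmetric_adjoint_comp_self (v j) x,
        T.isSymmetric_adjoint_comp_self.apply_eigenvectorBasis hn j, inner_smul_left,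
        T.sq_singularValues_fin hn]
      simp [v]
    rw [h2, real_inner_comm]
    ring
  -- Weights in `[0, 1]` whose total is the number of retained vectors; such a weighted sum of the
  -- decreasing `σⱼ²` is least when the weight sits on the last indices.
  set c : Fin n → ℝ := fun j => ∑ i : Fin n with q ≤ i.val, inner ℝ (v j) (u i) ^ 2 with hc
  have hsum : ∑ i : Fin n with q ≤ i.val, ‖T (u i)‖ ^ 2 =
      ∑ j : Fin n, T.singularValues j ^ 2 * c j := by
    simp_rw [hTu, hc, Finset.mul_sum]
    exact Finset.sum_comm
  have hc0 : ∀ j, 0 ≤ c j := fun j => Finset.sum_nonneg fun i _ => sq_nonneg _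
  have hc1 : ∀ j, c j ≤ 1 := by
    intro j
    calc c j ≤ ∑ i, inner ℝ (v j) (u i) ^ 2 :=
          Finset.sum_le_sum_of_subset_of_nonneg (Finset.subset_univ _) fun i _ _ => sq_nonneg _
      _ = ∑ i, inner ℝ (v j) (u i) * inner ℝ (u i) (v j) :=
          Finset.sum_congr rfl fun i _ => by rw [sq, real_inner_comm (v j) (u i)]
      _ = 1 := by rw [u.sum_inner_mul_inner, real_inner_self_eq_norm_sq]; simp
  have hcs : ∑ j, c j = ∑ j : Fin n with q ≤ j.val, (1 : ℝ) := by
    simp_rw [hc]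
    rw [Finset.sum_comm]
    refine Finset.sum_congr rfl fun i _ => ?_
    calc ∑ j, inner ℝ (v j) (u i) ^ 2 = ∑ j, inner ℝ (u i) (v j) * inner ℝ (v j) (u i) :=
          Finset.sum_congr rfl fun j _ => by rw [sq, real_inner_comm (v j) (u i)]
      _ = 1 := by rw [v.sum_inner_mul_inner, real_inner_self_eq_norm_sq]; simp
  have hanti : ∀ {a b : ℕ}, a ≤ b → T.singularValues b ^ 2 ≤ T.singularValues a ^ 2 :=
    fun h => pow_le_pow_left₀ (T.singularValues_nonneg _) (T.singularValues_antitone h) 2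
  rw [hsum]
  -- Both factors change sign at `j = q`, so each product is nonnegative; the `σ_q²` terms cancel by
  -- `hcs`.
  have key : 0 ≤ ∑ j : Fin n, (T.singularValues j ^ 2 - T.singularValues q ^ 2) *
      (c j - if q ≤ j.val then 1 else 0) := by
    refine Finset.sum_nonneg fun j _ => ?_
    split_ifs with h
    · exact mul_nonneg_of_nonpos_of_nonpos (by linarith [hanti h]) (by linarith [hc1 j])
    · exact mul_nonneg (by linarith [hanti (not_le.1 h).le]) (by linarith [hc0 j])
  have e : ∑ j : Fin n, (T.singularValues j ^ 2 - T.singularValues q ^ 2) *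
      (c j - if q ≤ j.val then 1 else 0) = ∑ j : Fin n, T.singularValues j ^ 2 * c j
      - ∑ j : Fin n with q ≤ j.val, T.singularValues j ^ 2
      - T.singularValues q ^ 2 * (∑ j, c j - ∑ j : Fin n with q ≤ j.val, (1 : ℝ)) := by
    rw [Finset.sum_filter, Finset.sum_filter, ← Finset.sum_sub_distrib, ← Finset.sum_sub_distrib,
      Finset.mul_sum, ← Finset.sum_sub_distrib]
    refine Finset.sum_congr rfl fun j _ => ?_
    split_ifs <;> ring
  rw [e, hcs] at key
  linarith

omit [FiniteDimensional ℝ E] [FiniteDimensional ℝ F] in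
/-- If `S` has operator norm at most `s`, discarding `q` orthonormal directions from `‖T + S‖²`
costs at most terms of order `√q s` and `q s²`. -/
theorem sum_norm_add_sq_lower_bound {n : ℕ} (T S : E →ₗ[ℝ] F)
    (u : OrthonormalBasis (Fin n) ℝ E) (q : ℕ) {s : ℝ} (hs : 0 ≤ s) (hS : ∀ x, ‖S x‖ ≤ s * ‖x‖) :
    ∑ i : Fin n with q ≤ i.val, ‖T (u i)‖ ^ 2 + ∑ i, ‖S (u i)‖ ^ 2
      - 2 * |∑ i, inner ℝ (T (u i)) (S (u i))|
      - 2 * (√(∑ i, ‖T (u i)‖ ^ 2) * (√q * s)) - q * s ^ 2 ≤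
      ∑ i : Fin n with q ≤ i.val, ‖(T + S) (u i)‖ ^ 2 := by
  classical
  have hSu : ∀ i, ‖S (u i)‖ ≤ s := fun i => by simpa using hS (u i)
  have hcard : ((Finset.univ.filter fun i : Fin n => ¬ q ≤ i.val).card : ℝ) ≤ q := by
    have : (Finset.univ.filter fun i : Fin n => ¬ q ≤ i.val).card ≤ (Finset.range q).card := by
      refine Finset.card_le_card_of_injOn Fin.val (fun i hi => ?_) Fin.val_injective.injOn
      simpa using hi
    simpa using this
  have hSq : ∑ i : Fin n with ¬ q ≤ i.val, ‖S (u i)‖ ^ 2 ≤ q * s ^ 2 := by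
    refine (Finset.sum_le_card_nsmul _ _ (s ^ 2) fun i _ =>
      pow_le_pow_left₀ (norm_nonneg _) (hSu i) 2).trans ?_
    rw [nsmul_eq_mul]
    exact mul_le_mul_of_nonneg_right hcard (sq_nonneg s)
  -- Only the discarded part of the cross term needs Cauchy–Schwarz: it has at most `q` directions,
  -- each with `‖S uᵢ‖ ≤ s`.
  have hcross : |∑ i : Fin n with ¬ q ≤ i.val, inner ℝ (T (u i)) (S (u i))| ≤
      √(∑ i, ‖T (u i)‖ ^ 2) * (√q * s) := by
    calc |∑ i : Fin n with ¬ q ≤ i.val, inner ℝ (T (u i)) (S (u i))|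
        ≤ ∑ i : Fin n with ¬ q ≤ i.val, ‖T (u i)‖ * ‖S (u i)‖ :=
          (Finset.abs_sum_le_sum_abs _ _).trans
            (Finset.sum_le_sum fun i _ => abs_real_inner_le_norm _ _)
      _ ≤ √(∑ i : Fin n with ¬ q ≤ i.val, ‖T (u i)‖ ^ 2) *
          √(∑ i : Fin n with ¬ q ≤ i.val, ‖S (u i)‖ ^ 2) :=
          Real.sum_mul_le_sqrt_mul_sqrt _ _ _
      _ ≤ √(∑ i, ‖T (u i)‖ ^ 2) * (√q * s) := by
          gcongr
          · exact Finset.subset_univ _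
          · refine (Real.sqrt_le_sqrt hSq).trans_eq ?_
            rw [Real.sqrt_mul (by positivity), Real.sqrt_sq hs]
  have hexp : ∀ i, ‖(T + S) (u i)‖ ^ 2 =
      ‖T (u i)‖ ^ 2 + 2 * inner ℝ (T (u i)) (S (u i)) + ‖S (u i)‖ ^ 2 := fun i => by
    rw [LinearMap.add_apply, norm_add_sq_real]
  have e1 := Finset.sum_filter_add_sum_filter_not Finset.univ (fun i : Fin n => q ≤ i.val)
    (fun i => ‖S (u i)‖ ^ 2)
  have e2 := Finset.sum_filter_add_sum_filter_not Finset.univ (fun i : Fin n => q ≤ i.val)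
    (fun i => (inner ℝ (T (u i)) (S (u i)) : ℝ))
  simp_rw [hexp, Finset.sum_add_distrib, ← Finset.mul_sum]
  have hcross' := (abs_le.1 hcross).2
  have habs := neg_abs_le (∑ i, (inner ℝ (T (u i)) (S (u i)) : ℝ))
  linarith

end LinearAlgebra

/-! ### Frobenius sums, rank and spectral norm of matrices -/

section Matrices

open Module Matrix

variable {I J : Type} [Fintype I] [Fintype J] [DecidableEq J]

/-- Parseval applied to each pair of rows. -/
theorem sum_inner_toEuclideanLin {n : ℕ} (A B : Matrix I J ℝ)
    (u : OrthonormalBasis (Fin n) ℝ (EuclideanSpace ℝ J)) :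
    ∑ a, inner ℝ (toEuclideanLin A (u a)) (toEuclideanLin B (u a)) = ∑ i, ∑ j, A i j * B i j := by
  have h : ∀ (M : Matrix I J ℝ) x i,
      toEuclideanLin M x i = inner ℝ (WithLp.toLp 2 (M i) : EuclideanSpace ℝ J) x := by
    intro M x i
    simp [PiLp.inner_apply, Matrix.mulVec, dotProduct, mul_comm]
  simp_rw [PiLp.inner_apply, h]
  rw [Finset.sum_comm]
  refine Finset.sum_congr rfl fun i _ => ?_
  have := u.sum_inner_mul_inner (WithLp.toLp 2 (A i) : EuclideanSpace ℝ J) (WithLp.toLp 2 (B i))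
  rw [PiLp.inner_apply] at this
  simp only [RCLike.inner_apply, conj_trivial] at this ⊢
  rw [← Finset.sum_congr rfl fun j _ => mul_comm (B i j) (A i j), ← this]
  refine Finset.sum_congr rfl fun a _ => ?_
  rw [mul_comm, real_inner_comm (u a) (WithLp.toLp 2 (B i))]

theorem sum_norm_sq_toEuclideanLin {n : ℕ} (A : Matrix I J ℝ)
    (u : OrthonormalBasis (Fin n) ℝ (EuclideanSpace ℝ J)) :
    ∑ a, ‖toEuclideanLin A (u a)‖ ^ 2 = ∑ i, ∑ j, A i j ^ 2 := by
  simp_rw [← real_inner_self_eq_norm_sq, sum_inner_toEuclideanLin, sq]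

theorem rank_eq_finrank_range_toEuclideanLin (A : Matrix I J ℝ) :
    A.rank = finrank ℝ (toEuclideanLin A).range :=
  A.rank_eq_finrank_range_toLin (PiLp.basisFun 2 ℝ I) (PiLp.basisFun 2 ℝ J)

theorem norm_toEuclideanLin_le (A : Matrix I J ℝ) (x : EuclideanSpace ℝ J) :
    ‖toEuclideanLin A x‖ ≤ spectralNorm A * ‖x‖ :=
  (LinearMap.toContinuousLinearMap (toEuclideanLin A)).le_opNorm x

theorem spectralNorm_nonneg (A : Matrix I J ℝ) : 0 ≤ spectralNorm A := norm_nonneg _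

-- Rank factorisation through a basis of the column space, padded with zero columns up to width `r`.
omit [Fintype I] [DecidableEq J] in
theorem exists_mul_transpose_of_rank_le (A : Matrix I J ℝ) {r : ℕ} (h : A.rank ≤ r) :
    ∃ (φ : Matrix I (Fin r) ℝ) (Γ : Matrix J (Fin r) ℝ), φ * Γ.transpose = A := by
  classical
  let V := A.mulVecLin.range
  have hV : finrank ℝ V = A.rank := rfl
  let b := finBasis ℝ V
  let x : J → V := fun j => ⟨A.mulVecLin (Pi.single j 1), LinearMap.mem_range_self _ _⟩
  refine ⟨of fun i l => if h : (l : ℕ) < finrank ℝ V then (b ⟨l, h⟩ : I → ℝ) i else 0,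
    of fun j l => if h : (l : ℕ) < finrank ℝ V then b.repr (x j) ⟨l, h⟩ else 0, ?_⟩
  ext i j
  have hx : A i j = ∑ l, b.repr (x j) l * (b l : I → ℝ) i := by
    have h1 := congrArg (fun y : V => (y : I → ℝ) i) (b.sum_repr (x j))
    simp only [Submodule.coe_sum, Finset.sum_apply, Submodule.coe_smul, Pi.smul_apply,
      smul_eq_mul] at h1
    rw [h1]
    simp [x]
  rw [hx, mul_apply, ← Finset.sum_subset (Finset.subset_univ
    (Finset.univ.map (Fin.castLEEmb (hV.le.trans h))))]
  · rw [Finset.sum_map]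
    refine Finset.sum_congr rfl fun l _ => ?_
    simp [mul_comm]
  · intro l _ hl
    have : ¬ (l : ℕ) < finrank ℝ V := fun hlt => hl (by
      simp only [Finset.mem_map, Finset.mem_univ, true_and]
      exact ⟨⟨l, hlt⟩, rfl⟩)
    simp [this]

end Matrices

end InteractiveFE

namespace InteractiveFE

/-! ### The profiled objective and the deterministic rate -/

section Objective

open Module Matrix

variable {I J : Type} [Fintype I] [Fintype J]

/-- Vectorisation of a matrix, as a linear map into Euclidean space. -/
noncomputable def vecLin (I J : Type) [Fintype I] [Fintype J] :
    Matrix I J ℝ →ₗ[ℝ] EuclideanSpace ℝ (I × J) where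
  toFun M := WithLp.toLp 2 fun p => M p.1 p.2
  map_add' _ _ := rfl
  map_smul' _ _ := rfl

theorem norm_sq_vecLin (M : Matrix I J ℝ) : ‖vecLin I J M‖ ^ 2 = ∑ i, ∑ j, M i j ^ 2 := by
  rw [EuclideanSpace.norm_sq_eq, Fintype.sum_prod_type]
  simp only [Real.norm_eq_abs, sq_abs]
  rfl

theorem norm_vecLin (M : Matrix I J ℝ) : ‖vecLin I J M‖ = √(∑ i, ∑ j, M i j ^ 2) := by
  rw [← norm_sq_vecLin, Real.sqrt_sq (norm_nonneg _)]

/-- The squared Frobenius distance of a matrix to the matrices that factor through `ℝ^r`. -/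
noncomputable def lowRankDistSq (r : ℕ) (E : Matrix I J ℝ) : ℝ :=
  ⨅ p : Matrix I (Fin r) ℝ × Matrix J (Fin r) ℝ, ∑ i, ∑ j, (E - p.1 * p.2.transpose) i j ^ 2

theorem lowRankDistSq_le (r : ℕ) (E : Matrix I J ℝ) (φ : Matrix I (Fin r) ℝ)
    (Γ : Matrix J (Fin r) ℝ) :
    lowRankDistSq r E ≤ ∑ i, ∑ j, (E - φ * Γ.transpose) i j ^ 2 :=
  ciInf_le ⟨0, by rintro _ ⟨p, rfl⟩; positivity⟩ (φ, Γ)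

theorem lowRankDistSq_add_le {r : ℕ} (A ε : Matrix I J ℝ) (h : A.rank ≤ r) :
    lowRankDistSq r (A + ε) ≤ ∑ i, ∑ j, ε i j ^ 2 := by
  obtain ⟨φ, Γ, hA⟩ := exists_mul_transpose_of_rank_le A h
  simpa [hA] using lowRankDistSq_le r (A + ε) φ Γ

/-- Gives continuity of the objective without showing that the infimum over factors is attained. -/
theorem lowRankDistSq_eq_infDist (r : ℕ) (E : Matrix I J ℝ) :
    lowRankDistSq r E = Metric.infDist (vecLin I J E) (Set.range
      fun p : Matrix I (Fin r) ℝ × Matrix J (Fin r) ℝ => vecLin I J (p.1 * p.2.transpose)) ^ 2 := by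
  have hd : ∀ p : Matrix I (Fin r) ℝ × Matrix J (Fin r) ℝ,
      dist (vecLin I J E) (vecLin I J (p.1 * p.2.transpose)) ^ 2 =
        ∑ i, ∑ j, (E - p.1 * p.2.transpose) i j ^ 2 := fun p => by
    rw [dist_eq_norm, ← map_sub, norm_sq_vecLin]
  refine le_antisymm ?_ (le_ciInf fun p => ?_)
  · refine (Real.sqrt_le_left Metric.infDist_nonneg).1
      ((Metric.le_infDist (Set.range_nonempty _)).2 ?_)
    rintro _ ⟨p, rfl⟩
    refine (Real.sqrt_le_left dist_nonneg).2 ?_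
    rw [hd]
    exact lowRankDistSq_le r E p.1 p.2
  · rw [← hd]
    exact pow_le_pow_left₀ Metric.infDist_nonneg (Metric.infDist_le_dist_of_mem
      (Set.mem_range_self p)) 2

theorem continuous_lowRankDistSq (r : ℕ) : Continuous (lowRankDistSq r : Matrix I J ℝ → ℝ) := by
  have h : Continuous (vecLin I J) := (vecLin I J).continuous_of_finiteDimensional
  have e : (lowRankDistSq r : Matrix I J ℝ → ℝ) = _ := funext (lowRankDistSq_eq_infDist r)
  rw [e]
  exact ((Metric.continuous_infDist_pt _).comp h).pow 2

variable [DecidableEq J]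

theorem sum_Icc_sq_singularValue_le {n q m : ℕ} (hm : m ≤ n) (B : Matrix I J ℝ) :
    ∑ s ∈ Finset.Icc (q + 1) m, singularValue B s ^ 2 ≤
      ∑ j : Fin n with q ≤ j.val, (toEuclideanLin B).singularValues j ^ 2 := by
  have h : ∑ j : Fin n with q ≤ j.val, (toEuclideanLin B).singularValues j ^ 2 =
      ∑ s ∈ Finset.Icc (q + 1) n, singularValue B s ^ 2 := by
    -- The shift reconciles `singularValue`, counted from 1, with `singularValues`, counted from 0.
    refine Finset.sum_nbij (fun j => j.val + 1) ?_ ?_ ?_ ?_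
    · intro j hj
      simp at hj ⊢
      omega
    · intro i _ j _ hij
      simpa [Fin.ext_iff] using hij
    · intro s hs
      simp only [Finset.coe_Icc, Set.mem_Icc] at hs
      refine ⟨⟨s - 1, by omega⟩, ?_, ?_⟩
      · simp
        omega
      · simp
        omega
    · intro j _
      simp [singularValue]
  rw [h]
  exact Finset.sum_le_sum_of_subset_of_nonneg (Finset.Icc_subset_Icc_right hm)
    fun _ _ _ => sq_nonneg _

/-- On basis vectors in `ker A ⊓ ker Z` the residual is just `a • B + ε`. The bound depends on `Z`
only through its rank, so it is uniform over all candidate factors. -/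
theorem sum_sq_lower_bound (B A ε Z : Matrix I J ℝ) (a : ℝ) (q : ℕ) (hq : A.rank + Z.rank ≤ q) :
    a ^ 2 * ∑ s ∈ Finset.Icc (q + 1) (min (Fintype.card I) (Fintype.card J)), singularValue B s ^ 2
      + ∑ i, ∑ j, ε i j ^ 2 - 2 * |∑ i, ∑ j, (a • B) i j * ε i j|
      - 2 * (‖vecLin I J (a • B)‖ * (√q * spectralNorm ε)) - q * spectralNorm ε ^ 2 ≤
      ∑ i, ∑ j, (a • B + A + ε - Z) i j ^ 2 := by
  obtain ⟨u, hu⟩ := exists_orthonormalBasis_mem_of_finrank_orthogonal_le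
    (n := Fintype.card J) (by simp)
    ((toEuclideanLin A).ker ⊓ (toEuclideanLin Z).ker) q (by
      refine (finrank_orthogonal_ker_inf_ker_le _ _).trans ?_
      rwa [← rank_eq_finrank_range_toEuclideanLin, ← rank_eq_finrank_range_toEuclideanLin])
  have h1 := sum_norm_add_sq_lower_bound (toEuclideanLin (a • B)) (toEuclideanLin ε) u q
    (spectralNorm_nonneg ε) (norm_toEuclideanLin_le ε)
  rw [sum_norm_sq_toEuclideanLin, sum_norm_sq_toEuclideanLin, sum_inner_toEuclideanLin,
    ← norm_vecLin] at h1
  have h2 := (sum_Icc_sq_singularValue_le (q := q) (min_le_right (Fintype.card I) _) B).trans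
    (sum_sq_singularValues_le_sum_norm_sq (by simp) (toEuclideanLin B) u q)
  have h3 : ∑ i : Fin (Fintype.card J) with q ≤ i.val, ‖toEuclideanLin (a • B) (u i)‖ ^ 2 =
      a ^ 2 * ∑ i : Fin (Fintype.card J) with q ≤ i.val, ‖toEuclideanLin B (u i)‖ ^ 2 := by
    rw [Finset.mul_sum]
    refine Finset.sum_congr rfl fun i _ => ?_
    rw [map_smul, LinearMap.smul_apply, norm_smul, mul_pow, Real.norm_eq_abs, sq_abs]
  have h4 : ∑ i : Fin (Fintype.card J) with q ≤ i.val,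
      ‖(toEuclideanLin (a • B) + toEuclideanLin ε) (u i)‖ ^ 2 ≤
      ∑ i, ∑ j, (a • B + A + ε - Z) i j ^ 2 := by
    rw [← sum_norm_sq_toEuclideanLin _ u]
    refine le_trans (le_of_eq (Finset.sum_congr rfl fun i hi => ?_))
      (Finset.sum_le_sum_of_subset_of_nonneg (Finset.subset_univ _) fun _ _ _ => sq_nonneg _)
    have hi' := hu i (by simpa using hi)
    have hA : toEuclideanLin A (u i) = 0 := hi'.1
    have hZ : toEuclideanLin Z (u i) = 0 := hi'.2
    simp only [map_add, map_sub, LinearMap.add_apply, LinearMap.sub_apply, hA, hZ, add_zero,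
      sub_zero]
  have h5 := mul_le_mul_of_nonneg_left h2 (sq_nonneg a)
  linarith

/-- The constant in the rate of convergence of the least-squares estimator. -/
noncomputable def rateConst (K : ℕ) (c b M : ℝ) : ℝ :=
  (2 * (K * M) * (1 + √(c + M) * M) + (c + M) * M ^ 2) / b + 1

-- Either `y ≤ 1`, which the `+ 1` covers, or `B ≤ B * y` and one factor `y` cancels.
omit [Fintype I] [DecidableEq J] [Fintype J] in
theorem le_div_add_one_of_quadratic_le {a B b y : ℝ} (hb : 0 < b) (ha : 0 ≤ a) (hB : 0 ≤ B)
    (h : b * y ^ 2 ≤ a * y + B) : y ≤ (a + B) / b + 1 := by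
  rcases le_or_gt y 1 with hy | hy
  · have : 0 ≤ (a + B) / b := by positivity
    linarith
  · have h1 : b * y ≤ a + B := by
      have : (b * y) * y ≤ (a + B) * y := by nlinarith
      exact le_of_mul_le_mul_right this (by linarith)
    have : y ≤ (a + B) / b := by rw [le_div_iff₀ hb]; linarith
    linarith

theorem norm_le_of_lowRankDistSq_le {K : ℕ} (X : Fin K → Matrix I J ℝ) (A ε : Matrix I J ℝ)
    {r : ℕ} {b c M τ : ℝ} (hb : 0 < b) (hM : 0 ≤ M)
    (hτ : τ = √(Fintype.card I) * √(Fintype.card J))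
    (hX : ∀ k, ‖vecLin I J (X k)‖ ≤ M * τ)
    (hε : spectralNorm ε ≤ M * max √(Fintype.card I) √(Fintype.card J))
    (hXε : ∀ k, |∑ i, ∑ j, X k i j * ε i j| ≤ M * τ)
    (hA : A.rank ≤ c) (hr : r ≤ M)
    (hns : ∀ δ : EuclideanSpace ℝ (Fin K), ‖δ‖ = 1 →
      b < ∑ s ∈ Finset.Icc (A.rank + r + 1) (min (Fintype.card I) (Fintype.card J)),
        singularValue (τ⁻¹ • ∑ k, δ k • X k) s ^ 2)
    (Δ : EuclideanSpace ℝ (Fin K))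
    (hΔ : lowRankDistSq r (∑ k, Δ k • X k + A + ε) ≤ ∑ i, ∑ j, ε i j ^ 2) :
    ‖Δ‖ ≤ rateConst K c b M * (1 / √(min (Fintype.card I : ℝ) (Fintype.card J))) := by
  have hc : 0 ≤ c := (Nat.cast_nonneg _).trans hA
  have hC : 0 ≤ rateConst K c b M := by unfold rateConst; positivity
  rcases (norm_nonneg Δ).eq_or_lt with h0 | hD
  · rw [← h0]
    positivity
  set D := ‖Δ‖ with hDdef
  have hδ : ‖D⁻¹ • Δ‖ = 1 := by
    rw [norm_smul, norm_inv, norm_norm, inv_mul_cancel₀ hD.ne']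
  have hns' := hns _ hδ
  set B := τ⁻¹ • ∑ k, (D⁻¹ • Δ) k • X k with hB
  -- With an empty dimension the singular value sum would be `0`, contradicting `b > 0`.
  have hmin : 1 ≤ min (Fintype.card I) (Fintype.card J) := by
    by_contra hlt
    rw [Finset.Icc_eq_empty (by omega)] at hns'
    simp at hns'
    linarith
  have hI : (1 : ℝ) ≤ Fintype.card I := by exact_mod_cast (le_min_iff.1 hmin).1
  have hJ : (1 : ℝ) ≤ Fintype.card J := by exact_mod_cast (le_min_iff.1 hmin).2
  set m : ℝ := (Fintype.card I : ℝ)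
  set n : ℝ := (Fintype.card J : ℝ)
  set μ := max √m √n with hμ
  set g := √(min m n) with hg
  have hμ1 : 1 ≤ μ := le_max_of_le_left (Real.one_le_sqrt.2 hI)
  have hg1 : 1 ≤ g := Real.one_le_sqrt.2 (le_min hI hJ)
  have hτμ : τ = μ * g := by
    rw [hτ, hμ, hg]
    rcases le_total m n with h | h
    · rw [min_eq_left h, max_eq_right (Real.sqrt_le_sqrt h), mul_comm]
    · rw [min_eq_right h, max_eq_left (Real.sqrt_le_sqrt h)]
  have hτ0 : 0 < τ := by rw [hτμ]; positivity
  have haB : (τ * D) • B = ∑ k, Δ k • X k := by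
    rw [hB, smul_smul, mul_assoc, mul_comm, mul_assoc, inv_mul_cancel₀ hτ0.ne', mul_one,
      Finset.smul_sum]
    refine Finset.sum_congr rfl fun k _ => ?_
    rw [smul_smul, PiLp.smul_apply, smul_eq_mul, mul_inv_cancel_left₀ hD.ne']
  have hΔk : ∀ k, |Δ k| ≤ D := fun k => by simpa using PiLp.norm_apply_le Δ k
  have hnorm : ‖vecLin I J (∑ k, Δ k • X k)‖ ≤ K * M * (τ * D) := by
    rw [map_sum]
    refine (norm_sum_le_of_le Finset.univ (f := fun k => vecLin I J (Δ k • X k))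
      (n := fun _ => D * (M * τ)) fun k _ => ?_).trans_eq ?_
    · rw [map_smul, norm_smul]
      exact mul_le_mul (hΔk k) (hX k) (norm_nonneg _) hD.le
    · simp
      ring
  have hinner : |∑ i, ∑ j, (∑ k, Δ k • X k) i j * ε i j| ≤ K * M * (τ * D) := by
    have e : ∑ i, ∑ j, (∑ k, Δ k • X k) i j * ε i j = ∑ k, Δ k * ∑ i, ∑ j, X k i j * ε i j := by
      simp_rw [Matrix.sum_apply, Matrix.smul_apply, smul_eq_mul, Finset.sum_mul, Finset.mul_sum]
      calc _ = ∑ i, ∑ k, ∑ j, Δ k * X k i j * ε i j :=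
            Finset.sum_congr rfl fun i _ => Finset.sum_comm
        _ = ∑ k, ∑ i, ∑ j, Δ k * X k i j * ε i j := Finset.sum_comm
        _ = _ := by simp_rw [mul_assoc]
    rw [e]
    refine (Finset.abs_sum_le_sum_abs _ _).trans ((Finset.sum_le_sum (g := fun _ => D * (M * τ))
      fun k _ => ?_).trans_eq ?_)
    · rw [abs_mul]
      exact mul_le_mul (hΔk k) (hXε k) (abs_nonneg _) hD.le
    · simp
      ring
  have hlow : (τ * D) ^ 2 * b + ∑ i, ∑ j, ε i j ^ 2 - 2 * (K * M * (τ * D))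
      - 2 * (K * M * (τ * D) * (√(c + M) * (M * μ))) - (c + M) * (M * μ) ^ 2 ≤
      lowRankDistSq r (∑ k, Δ k • X k + A + ε) := by
    refine le_ciInf fun p => ?_
    have h := sum_sq_lower_bound B A ε (p.1 * p.2.transpose) (τ * D) (A.rank + r) (by
      have := (rank_mul_le_left p.1 p.2.transpose).trans ((rank_le_card_width p.1).trans_eq
        (Fintype.card_fin r))
      omega)
    rw [haB] at h
    refine le_trans ?_ h
    have hs := spectralNorm_nonneg ε
    have hq : ((A.rank + r : ℕ) : ℝ) ≤ c + M := by push_cast; linarith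
    have h1 : (τ * D) ^ 2 * b ≤ (τ * D) ^ 2 * ∑ s ∈ Finset.Icc (A.rank + r + 1)
        (min (Fintype.card I) (Fintype.card J)), singularValue B s ^ 2 := by gcongr
    have h2 : ‖vecLin I J (∑ k, Δ k • X k)‖ * (√((A.rank + r : ℕ) : ℝ) * spectralNorm ε) ≤
        K * M * (τ * D) * (√(c + M) * (M * μ)) := by gcongr
    have h3 : ((A.rank + r : ℕ) : ℝ) * spectralNorm ε ^ 2 ≤ (c + M) * (M * μ) ^ 2 := by gcongr
    linarith
  have hquad : b * (g * D) ^ 2 ≤ 2 * (K * M) * (1 + √(c + M) * M) * (g * D) + (c + M) * M ^ 2 := by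
    have h := hlow.trans hΔ
    have hμ2 : 0 < μ ^ 2 := by positivity
    have e : τ * D = μ * (g * D) := by rw [hτμ, mul_assoc]
    rw [e] at h
    -- The exogeneity term carries only one `μ`; since `μ ≥ 1` it can be raised to `μ²`, after which
    -- `μ²` divides out.
    have h6 : K * M * (μ * (g * D)) ≤ K * M * (μ ^ 2 * (g * D)) := by
      have : μ ≤ μ ^ 2 := by nlinarith
      gcongr
    refine le_of_mul_le_mul_left (a := μ ^ 2) ?_ hμ2
    linear_combination h + 2 * h6
  have hfin := le_div_add_one_of_quadratic_le hb (by positivity) (by positivity) hquad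
  rw [mul_one_div, le_div_iff₀ (by positivity), mul_comm]
  exact hfin

end Objective

end InteractiveFE

namespace InteractiveFE

/-! ### From arrays to flattenings; existence of the estimator -/

section Tensors

variable {d K : ℕ} {N : Fin d → ℕ}

theorem sum_flatten_mul_flatten (A B : Tensor N) (n : Fin d) :
    ∑ i, ∑ j, flatten A n i j * flatten B n i j = vecInner A B := by
  rw [vecInner, ← (Equiv.piSplitAt n fun m => Fin (N m)).symm.sum_comp, Fintype.sum_prod_type]
  rfl

theorem norm_vecLin_flatten (A : Tensor N) (n : Fin d) :
    ‖vecLin _ _ (flatten A n)‖ = frobNorm A := by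
  have h := sum_flatten_mul_flatten A A n
  simp_rw [vecInner, ← sq] at h
  rw [norm_vecLin, frobNorm, h]

theorem card_restIdx (N : Fin d → ℕ) (n : Fin d) :
    Fintype.card (RestIdx N n) = restSize N n := by
  rw [Fintype.card_pi, restSize]
  simp only [Fintype.card_fin]
  exact (Finset.prod_subtype (Finset.univ.erase n) (by simp) N).symm

theorem prod_sqrt_eq (N : Fin d → ℕ) (n : Fin d) :
    ∏ m, √(N m : ℝ) = √(N n : ℝ) * √(restSize N n : ℝ) := by
  rw [restSize, ← Finset.mul_prod_erase Finset.univ _ (Finset.mem_univ n), Nat.cast_prod,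
    Real.sqrt_prod _ fun _ _ => Nat.cast_nonneg _]

theorem lsObjective_eq {X : Fin K → Tensor N} {Y A ε : Tensor N} {β₀ : EuclideanSpace ℝ (Fin K)}
    (hY : ∀ i, Y i = ∑ k, X k i * β₀ k + A i + ε i) (r : ℕ) (n : Fin d)
    (β : EuclideanSpace ℝ (Fin K)) :
    lsObjective Y X β r n = lowRankDistSq r
      (∑ k, (β₀ - β) k • flatten (X k) n + flatten A n + flatten ε n) := by
  have e : flatten Y n - ∑ k, β k • flatten (X k) n =
      ∑ k, (β₀ - β) k • flatten (X k) n + flatten A n + flatten ε n := by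
    ext i j
    simp only [flatten, Matrix.sub_apply, Matrix.add_apply, Matrix.sum_apply, Matrix.smul_apply,
      Matrix.of_apply, smul_eq_mul, PiLp.sub_apply, hY, sub_mul, Finset.sum_sub_distrib]
    simp_rw [mul_comm (β₀ _)]
    ring
  rw [lsObjective, lowRankDistSq, e]

/-- Where the regressors are non-singular and the norms are controlled, least-squares estimates
exist and every one of them obeys the rate. -/
theorem exists_isLSEstimate_and_norm_sub_le {X : Fin K → Tensor N} {Y A ε : Tensor N}
    {β₀ : EuclideanSpace ℝ (Fin K)} (hY : ∀ i, Y i = ∑ k, X k i * β₀ k + A i + ε i)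
    {r : ℕ} {n : Fin d} {b c M : ℝ} (hb : 0 < b) (hM : 0 ≤ M)
    (hX : ∀ k, frobNorm (X k) ≤ M * ∏ m, √(N m : ℝ))
    (hε : spectralNorm (flatten ε n) ≤ M * max √(N n : ℝ) √(restSize N n : ℝ))
    (hXε : ∀ k, |vecInner (X k) ε| ≤ M * ∏ m, √(N m : ℝ))
    (hA : multilinearRank A n ≤ c) (hAr : multilinearRank A n ≤ r) (hr : r ≤ M)
    (hns : ∀ δ : EuclideanSpace ℝ (Fin K), ‖δ‖ = 1 →
      b < ∑ s ∈ Finset.Icc (multilinearRank A n + r + 1) (min (N n) (restSize N n)),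
        singularValue ((∏ m, √(N m : ℝ))⁻¹ • ∑ k, δ k • flatten (X k) n) s ^ 2) :
    (∃ β, IsLSEstimate Y X r n β) ∧ ∀ β, IsLSEstimate Y X r n β →
      ‖β - β₀‖ ≤ rateConst K c b M * (1 / √(min (N n : ℝ) (restSize N n : ℝ))) := by
  have hbound : ∀ β, lsObjective Y X β r n ≤ lsObjective Y X β₀ r n →
      ‖β - β₀‖ ≤ rateConst K c b M * (1 / √(min (N n : ℝ) (restSize N n : ℝ))) := by
    intro β hβ
    have h0 : lsObjective Y X β₀ r n ≤ ∑ i, ∑ j, flatten ε n i j ^ 2 := by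
      rw [lsObjective_eq hY]
      simpa using lowRankDistSq_add_le (flatten A n) (flatten ε n) hAr
    have h := norm_le_of_lowRankDistSq_le (fun k => flatten (X k) n) (flatten A n) (flatten ε n)
      (r := r) (b := b) (c := c) (M := M) (τ := ∏ m, √(N m : ℝ)) hb hM
      (by rw [Fintype.card_fin, card_restIdx, prod_sqrt_eq N n])
      (fun k => by rw [norm_vecLin_flatten]; exact hX k)
      (by rw [Fintype.card_fin, card_restIdx]; exact hε)
      (fun k => by rw [sum_flatten_mul_flatten]; exact hXε k) hA hr
      (by rw [Fintype.card_fin, card_restIdx]; exact hns) (β₀ - β)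
      (by rw [← lsObjective_eq hY]; exact hβ.trans h0)
    rwa [norm_sub_rev, Fintype.card_fin, card_restIdx] at h
  refine ⟨?_, fun β hβ => hbound β (hβ β₀)⟩
  have hcont : Continuous fun β => lsObjective Y X β r n := by
    simp_rw [lsObjective_eq hY]
    refine (continuous_lowRankDistSq r).comp ?_
    fun_prop
  -- Outside the closed ball given by the rate, the objective exceeds its value at `β₀`, so a
  -- continuous objective attains its minimum.
  refine hcont.exists_forall_le' β₀ ?_
  filter_upwards [(isCompact_closedBall β₀ (rateConst K c b M *
    (1 / √(min (N n : ℝ) (restSize N n : ℝ))))).compl_mem_cocompact] with β hβ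
  by_contra hlt
  exact hβ (mem_closedBall_iff_norm.2 (hbound β (not_le.1 hlt).le))

end Tensors

/-! ### Calculus of likely events -/

section Probability

variable {Ω : Type*} [MeasurableSpace Ω] {P : Measure Ω}

/-- The events `E M t` have asymptotically probability close to one for large `M`. -/
def EventuallyLikely (P : Measure Ω) (E : ℝ → ℕ → Ω → Prop) : Prop :=
  ∀ η : ℝ, 0 < η → ∃ M₀ : ℝ, ∀ M, M₀ ≤ M → ∀ᶠ t in atTop, P {ω | ¬ E M t ω} ≤ ENNReal.ofReal η

/-- Nonnegativity of `a` upgrades one admissible constant to all larger ones, so that several bounds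
can share a single `M`. -/
theorem IsBigOp.eventuallyLikely {Z : ℕ → Ω → ℝ} {a : ℕ → ℝ} (h : IsBigOp P Z a)
    (ha : ∀ t, 0 ≤ a t) : EventuallyLikely P fun M t ω => |Z t ω| ≤ M * a t := by
  intro η hη
  obtain ⟨M₀, -, hM₀⟩ := h η hη
  refine ⟨M₀, fun M hM => hM₀.mono fun t ht => (measure_mono fun ω hω => ?_).trans ht⟩
  exact (mul_le_mul_of_nonneg_right hM (ha t)).trans_lt (not_le.1 hω)

theorem WPA1.eventuallyLikely {E : ℕ → Ω → Prop} (h : WPA1 P E) :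
    EventuallyLikely P fun _ t ω => E t ω := fun _ hη =>
  ⟨0, fun _ _ => h.eventually_le_const (ENNReal.ofReal_pos.2 hη)⟩

theorem eventuallyLikely_of_ae {E : ℕ → Ω → Prop} (h : ∀ t, ∀ᵐ ω ∂P, E t ω) :
    EventuallyLikely P fun _ t ω => E t ω := fun _ _ =>
  ⟨0, fun _ _ => Eventually.of_forall fun t => (ae_iff.1 (h t)).trans_le zero_le⟩

theorem EventuallyLikely.and {E F : ℝ → ℕ → Ω → Prop} (hE : EventuallyLikely P E)
    (hF : EventuallyLikely P F) : EventuallyLikely P fun M t ω => E M t ω ∧ F M t ω := by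
  intro η hη
  obtain ⟨M₁, h₁⟩ := hE (η / 2) (by positivity)
  obtain ⟨M₂, h₂⟩ := hF (η / 2) (by positivity)
  refine ⟨max M₁ M₂, fun M hM => ?_⟩
  filter_upwards [h₁ M ((le_max_left _ _).trans hM), h₂ M ((le_max_right _ _).trans hM)]
    with t ht₁ ht₂
  calc P {ω | ¬(E M t ω ∧ F M t ω)} ≤ P ({ω | ¬ E M t ω} ∪ {ω | ¬ F M t ω}) :=
        measure_mono fun ω hω => not_and_or.1 hω
    _ ≤ ENNReal.ofReal (η / 2) + ENNReal.ofReal (η / 2) :=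
        (measure_union_le _ _).trans (add_le_add ht₁ ht₂)
    _ = ENNReal.ofReal η := by
        rw [← ENNReal.ofReal_add (by positivity) (by positivity), add_halves]

theorem eventuallyLikely_forall {ι : Type*} [Finite ι] {E : ι → ℝ → ℕ → Ω → Prop}
    (h : ∀ k, EventuallyLikely P (E k)) : EventuallyLikely P fun M t ω => ∀ k, E k M t ω := by
  classical
  have := Fintype.ofFinite ι
  suffices ∀ s : Finset ι, EventuallyLikely P fun M t ω => ∀ k ∈ s, E k M t ω by
    simpa using this Finset.univ
  intro s
  induction s using Finset.induction_on with
  | empty => exact fun _ _ => ⟨0, by simp⟩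
  | insert k s _ ih => simpa using (h k).and ih

theorem EventuallyLikely.isBigOp {E : ℝ → ℕ → Ω → Prop} (hE : EventuallyLikely P E)
    {Z : ℕ → Ω → ℝ} {a : ℕ → ℝ} {C : ℝ → ℝ} (hC : ∀ M, 0 ≤ M → 0 < C M)
    (h : ∀ M, 0 ≤ M → ∀ t ω, E M t ω → |Z t ω| ≤ C M * a t) : IsBigOp P Z a := by
  intro η hη
  obtain ⟨M₀, hM₀⟩ := hE η hη
  -- `M₀` may be negative, while `C` is controlled only on `M ≥ 0`.
  refine ⟨C (max M₀ 0), hC _ (le_max_right _ _), ?_⟩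
  filter_upwards [hM₀ _ (le_max_left M₀ 0)] with t ht
  exact (measure_mono fun ω hω hEω => (h _ (le_max_right _ _) t ω hEω).not_gt hω).trans ht

theorem rateConst_pos {K : ℕ} {c b M : ℝ} (hc : 0 ≤ c) (hb : 0 < b) (hM : 0 ≤ M) :
    0 < rateConst K c b M := by
  unfold rateConst
  positivity

end Probability

end InteractiveFE
-- The stochastic rate
open InteractiveFE in
theorem mainTheorem2
    {Ω : Type*} [MeasurableSpace Ω] (P : Measure Ω) [IsProbabilityMeasure P]
    (d K : ℕ) (N : ℕ → Fin d → ℕ)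
    -- the model
    (β₀ : EuclideanSpace ℝ (Fin K))
    (X : ∀ t : ℕ, Fin K → Ω → Tensor (N t))
    (L : ℕ → ℕ) (φ : ∀ t : ℕ, Ω → Fin (L t) → ∀ n : Fin d, Fin (N t n) → ℝ)
    (ε : ∀ t : ℕ, Ω → Tensor (N t))
    (Y : ∀ t : ℕ, Ω → Tensor (N t))
    (hY : ∀ t ω i, Y t ω i =
      ∑ k, X t k ω i * β₀ k + interactiveEffect (φ t ω) i + ε t ω i)
    -- the dimensions considered
    (𝓛 : Set (Fin d)) (h𝓛 : 𝓛.Nonempty)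
    -- the number of estimated factors: bounded, and at least the true number
    (rhat : Fin d → ℕ → Ω → ℕ)
    (hrhat_bdd : ∀ n ∈ 𝓛, IsBigOp P (fun t ω => (rhat n t ω : ℝ)) (fun _ => 1))
    (hrhat_ge : ∀ n ∈ 𝓛, WPA1 P fun t ω =>
      multilinearRank (interactiveEffect (φ t ω)) n ≤ rhat n t ω)
    -- bounded norms of covariates and noise
    (hX_norm : ∀ k, IsBigOp P (fun t ω => frobNorm (X t k ω))
      (fun t => ∏ n, √(N t n : ℝ)))
    (hε_norm : ∀ n ∈ 𝓛, IsBigOp P (fun t ω => spectralNorm (flatten (ε t ω) n))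
      (fun t => max √(N t n : ℝ) √(restSize (N t) n : ℝ)))
    -- weak exogeneity
    (hexog : ∀ k, IsBigOp P (fun t ω => vecInner (X t k ω) (ε t ω))
      (fun t => ∏ n, √(N t n : ℝ)))
    -- low multilinear rank
    (hrank : ∃ c : ℕ, 0 < c ∧ ∀ n ∈ 𝓛, ∀ t, ∀ᵐ ω ∂P,
      multilinearRank (interactiveEffect (φ t ω)) n < c)
    -- non-singularity
    (hnonsing : ∀ n ∈ 𝓛, ∃ b : ℝ, 0 < b ∧ WPA1 P fun t ω =>
      ∀ δ : EuclideanSpace ℝ (Fin K), ‖δ‖ = 1 →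
        b < ∑ s ∈ Finset.Icc
              (multilinearRank (interactiveEffect (φ t ω)) n + rhat n t ω + 1)
              (min (N t n) (restSize (N t) n)),
            singularValue
              ((∏ m, √(N t m : ℝ))⁻¹ • ∑ k, δ k • flatten (X t k ω) n) s ^ 2)
    -- the estimator: any selection from the set of minimisers, wherever that set is non-empty
    (βhat : Fin d → ℕ → Ω → EuclideanSpace ℝ (Fin K))
    (hβhat : ∀ n ∈ 𝓛, ∀ t ω,
      (∃ β, IsLSEstimate (Y t ω) (fun k => X t k ω) (rhat n t ω) n β) →
        IsLSEstimate (Y t ω) (fun k => X t k ω) (rhat n t ω) n (βhat n t ω)) :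
    ∀ n ∈ 𝓛, IsBigOp P (fun t ω => ‖βhat n t ω - β₀‖)
      (fun t => 1 / √(min (N t n : ℝ) (restSize (N t) n : ℝ))) := by
  intro n hn
  obtain ⟨c, -, hc⟩ := hrank
  obtain ⟨b, hb, hns⟩ := hnonsing n hn
  have hprod : ∀ t, 0 ≤ ∏ m, √(N t m : ℝ) := fun t =>
    Finset.prod_nonneg fun _ _ => Real.sqrt_nonneg _
  have hgood := (eventuallyLikely_forall fun k => (hX_norm k).eventuallyLikely hprod).and
    ((eventuallyLikely_forall fun k => (hexog k).eventuallyLikely hprod).and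
    (((hε_norm n hn).eventuallyLikely fun t => le_max_of_le_left (Real.sqrt_nonneg _)).and
    (((hrhat_bdd n hn).eventuallyLikely fun _ => zero_le_one).and
    ((hrhat_ge n hn).eventuallyLikely.and
    (hns.eventuallyLikely.and (eventuallyLikely_of_ae (hc n hn)))))))
  refine hgood.isBigOp (C := rateConst K c b) (fun M hM => rateConst_pos c.cast_nonneg hb hM) ?_
  rintro M hM t ω ⟨h1, h2, h3, h4, h5, h6, h7⟩
  obtain ⟨hex, hrate⟩ := exists_isLSEstimate_and_norm_sub_le (X := fun k => X t k ω)
    (hY t ω) (r := rhat n t ω) (n := n) (c := c) hb hM (fun k => (le_abs_self _).trans (h1 k))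
    ((le_abs_self _).trans h3) h2 (by exact_mod_cast h7.le) h5
    (by simpa using h4) h6
  rw [abs_norm]
  -- Existence of a minimiser on the good event is what rules out the arbitrary value of `βhat`
  -- there.
  exact hrate _ (hβhat n hn t ω hex)
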